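/- \textbf{Theorem.} Let $n,s$ be natural numbers, let $\mathcal J$ be a partition of $\{1,\dots,n\}$, and for each $J\in\mathcal J$ let $\kappa_J:\mathbb R^{|J|}\to[0,\infty]$ be a closed gauge, i.e. a nonnegative, positively homogeneous, lower semicontinuous convex function with $\kappa_J(0)=0$. With $x_J$ the subvector of $x\in\mathbb R^n$ indexed by $J$ and $\|\cdot\|$ the Euclidean norm, put $$h(x)=\sum_{J\in\mathcal J}\bigl(\|x_J\|+\kappa_J(x_J)\bigr),\qquad \operatorname{dom}h=\{x: h(x)<\infty\}.$$ Let $A_1\in\mathbb R^{s\times n}$, and let $q_1:\mathbb R^{s}\to\mathbb R$ be twice continuously differentiable, bounded below, and strongly convex on every compact convex set (with a modulus that may depend on the set). Let $$F(x)=h(x)+\delta_{\{q_1(A_1\cdot)\le 0\}}(x),$$ where $\delta_C$ is $0$ on $C$ and $+\infty$ off $C$. Suppose that there is $x^\odot\in\operatorname{dom}h$ with $q_1(A_1x^\odot)<0$ (Slater condition), and that the origin is not feasible, i.e. $0\notin\{x\in\operatorname{dom}h: q_1(A_1x)\le 0\}$. Then $F$ is a Kurdyka--\L ojasiewicz (KL)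 function with exponent $\tfrac12$. Here a function $f:\mathbb R^n\to(-\infty,\infty]$ is a \emph{KL function with exponent $\alpha\in[0,1)$} if it is proper and lower semicontinuous and for every $\hat x$ with $\partial f(\hat x)\ne\emptyset$ there are $a_0>0$, $a\in(0,\infty]$ and a neighborhood $V$ of $\hat x$ such that, with $\phi(\nu)=a_0\nu^{1-\alpha}$, $$\phi'\bigl(f(x)-f(\hat x)\bigr)\,\operatorname{dist}\bigl(0,\partial f(x)\bigr)\ge 1\quad\text{for all }x\in V\text{ with }f(\hat x)<f(x)<f(\hat x)+a,$$ where $\operatorname{dist}(0,\emptyset)=+\infty$. The set $\partial f(x)$ is the limiting subdifferential: it is empty if $f(x)=\infty$, and otherwise $v\in\partial f(x)$ if and only if there are $x^k\to x$ with $f(x^k)\to f(x)$ and $v^k\to v$ such that, for every $k$, $f(x^k)<\infty$ and $\liminf_{y\to x^k,\,y\ne x^k}\frac{f(y)-f(x^k)-\langle v^k,y-x^k\rangle}{\|y-x^k\|}\ge 0$. -/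

import Mathlib

open Filter Topology

noncomputable section

namespace KLExp

/-! Extended-real-valued functions on a Euclidean space -/

section General

variable {E : Type*} [NormedAddCommGroup E] [InnerProductSpace ℝ E]

/-- The effective domain `dom h = {x | h x < ∞}`. -/
def dom (h : E → EReal) : Set E := {x | h x < ⊤}

/-- `h` is proper: it never takes the value `-∞` and its domain is nonempty. -/
def IsProper (h : E → EReal) : Prop := (∀ x, ⊥ < h x) ∧ (dom h).Nonempty

/-- Convexity of an extended-real-valued function: its epigraph is convex. -/
def IsConvexFn (h : E → EReal) : Prop :=
  Convex ℝ {p : E × ℝ | h p.1 ≤ (p.2 : EReal)}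

/-- The indicator function `δ_C`, equal to `0` on `C` and to `∞` off `C`. -/
def indicatorFn (C : Set E) (x : E) : EReal :=
  open Classical in if x ∈ C then 0 else ⊤

/-- A closed gauge: a nonnegative, positively homogeneous, closed (lower semicontinuous) convex
function that vanishes at the origin. -/
structure IsClosedGauge (κ : E → EReal) : Prop where
  nonneg : ∀ x, 0 ≤ κ x
  pos_homogeneous : ∀ (t : ℝ) (x : E), 0 < t → κ (t • x) = (t : EReal) * κ x
  closed : LowerSemicontinuous κ
  convex : IsConvexFn κ
  map_zero : κ 0 = 0

/-- The regular (Fréchet) subdifferential of `h` at `x` (empty if `x ∉ dom h`). -/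
def regularSubdiff (h : E → EReal) (x : E) : Set E :=
  {v | x ∈ dom h ∧
    0 ≤ liminf (fun y : E =>
      (h y - h x - ((inner ℝ v (y - x) : ℝ) : EReal)) / ((‖y - x‖ : ℝ) : EReal)) (𝓝[≠] x)}

/-- The limiting subdifferential `∂h(x)` (empty if `x ∉ dom h`). -/
def subdiff (h : E → EReal) (x : E) : Set E :=
  {v | x ∈ dom h ∧ ∃ (xs vs : ℕ → E),
    Tendsto xs atTop (𝓝 x) ∧ Tendsto (fun k => h (xs k)) atTop (𝓝 (h x)) ∧
    (∀ k, vs k ∈ regularSubdiff h (xs k)) ∧ Tendsto vs atTop (𝓝 v)}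

/-- `dom ∂h = {x | ∂h(x) ≠ ∅}`. -/
def domSubdiff (h : E → EReal) : Set E := {x | (subdiff h x).Nonempty}

/-- `h` satisfies the Kurdyka-Łojasiewicz property at `x₀` with the desingularizing function `φ`
on `[0, a)`, where `a ∈ (0, ∞]`. The distance from `0` to `∂h(x)` is taken in `[0, ∞]`, so that
it is `∞` when `∂h(x)` is empty. -/
structure KLPropertyWith (h : E → EReal) (x₀ : E) (a : EReal) (φ : ℝ → ℝ) : Prop where
  a_pos : 0 < a
  map_zero : φ 0 = 0
  nonneg : ∀ ν : ℝ, 0 ≤ ν → (ν : EReal) < a → 0 ≤ φ ν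
  continuousOn : ContinuousOn φ {ν : ℝ | 0 ≤ ν ∧ (ν : EReal) < a}
  concaveOn : ConcaveOn ℝ {ν : ℝ | 0 ≤ ν ∧ (ν : EReal) < a} φ
  contDiffOn : ContDiffOn ℝ 1 φ {ν : ℝ | 0 < ν ∧ (ν : EReal) < a}
  deriv_pos : ∀ ν : ℝ, 0 < ν → (ν : EReal) < a → 0 < deriv φ ν
  ineq : ∃ V ∈ 𝓝 x₀, ∀ x ∈ V, h x₀ < h x → h x < h x₀ + a →
    1 ≤ ENNReal.ofReal (deriv φ (h x - h x₀).toReal) * Metric.infEDist 0 (subdiff h x)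

/-- `h` satisfies the KL property at `x₀` with exponent `α`: the desingularizing function can be
chosen as `φ(ν) = a₀ ν ^ (1 - α)` for some `a₀ > 0`. -/
def HasKLExponentAt (h : E → EReal) (x₀ : E) (α : ℝ) : Prop :=
  ∃ (a : EReal) (a₀ : ℝ), 0 < a₀ ∧ KLPropertyWith h x₀ a (fun ν => a₀ * ν ^ (1 - α))

/-- `h` is a KL function with exponent `α ∈ [0, 1)`: it is proper and closed and satisfies the KL
property with exponent `α` at every point of `dom ∂h`. -/
structure IsKLFunctionWithExponent (h : E → EReal) (α : ℝ) : Prop where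
  exponent_mem : α ∈ Set.Ico (0 : ℝ) 1
  proper : IsProper h
  closed : LowerSemicontinuous h
  kl : ∀ x ∈ domSubdiff h, HasKLExponentAt h x α

/-- `q` is strongly convex on every compact convex set (with a modulus depending on the set),
twice continuously differentiable and bounded below. -/
structure LocallyStronglyConvexC2 (q : E → ℝ) : Prop where
  strongConvexOn : ∀ K : Set E, IsCompact K → Convex ℝ K →
    ∃ m : ℝ, 0 < m ∧ StrongConvexOn K m q
  contDiff : ContDiff ℝ 2 q
  bddBelow : BddBelow (Set.range q)

end General

/-! The problem data on `ℝⁿ` -/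

/-- The subvector `x_J` of `x` indexed by `J`. -/
def subvec {n : ℕ} (J : Finset (Fin n)) (x : EuclideanSpace ℝ (Fin n)) : EuclideanSpace ℝ J :=
  WithLp.toLp 2 (fun i : J => x i)

/-- `h(x) = ∑_J (‖x_J‖ + κ_J(x_J))`, where `J` runs over the blocks of the partition `P` of the
set of coordinates. -/
def groupGauge {n : ℕ} (P : Finpartition (Finset.univ : Finset (Fin n)))
    (κ : (J : Finset (Fin n)) → EuclideanSpace ℝ J → EReal)
    (x : EuclideanSpace ℝ (Fin n)) : EReal :=
  ∑ J ∈ P.parts, (((‖subvec J x‖ : ℝ) : EReal) + κ J (subvec J x))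

/-- The matrix-vector product `A x` between Euclidean spaces. -/
def matMul {s n : ℕ} (A : Matrix (Fin s) (Fin n) ℝ) (x : EuclideanSpace ℝ (Fin n)) :
    EuclideanSpace ℝ (Fin s) :=
  WithLp.toLp 2 (A.mulVec x.ofLp)

/-- The feasible set `{x ∈ dom h | q(A x) ≤ 0}`. -/
def feasibleSet {s n : ℕ} (h : EuclideanSpace ℝ (Fin n) → EReal)
    (q : EuclideanSpace ℝ (Fin s) → ℝ) (A : Matrix (Fin s) (Fin n) ℝ) :
    Set (EuclideanSpace ℝ (Fin n)) :=
  {x | x ∈ dom h ∧ q (matMul A x) ≤ 0}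

/-- The extended objective `F(x) = h(x) + δ_{q(A ·) ≤ 0}(x)`. -/
def extObjective {s n : ℕ} (h : EuclideanSpace ℝ (Fin n) → EReal)
    (q : EuclideanSpace ℝ (Fin s) → ℝ) (A : Matrix (Fin s) (Fin n) ℝ)
    (x : EuclideanSpace ℝ (Fin n)) : EReal :=
  h x + indicatorFn {y | q (matMul A y) ≤ 0} x

end KLExp

end

/-! `F` is convex, so limiting subgradients are global ones. Near a point of its domain that does
not minimize `F` they are bounded away from zero, and the KL inequality is immediate. At a minimizer
`x₀` it suffices that `F x - F x₀` dominates the squared distance from `x` to some minimizer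
(`hasKLExponentAt_half_of_growth`); the growth is `exists_quadratic_growth`.

Write `H` for the finite part of `h`. Since the origin is infeasible and `H` vanishes only there, `H
x₀ > 0 = H 0`, which together with Slater gives a strictly positive multiplier `r`
(`exists_pos_multiplier`). With `b = A x₀` and `l = -r q'(b) ∘ A`, optimality says that `l ≤ H` on
the domain with equality at `x₀`. The excess `F x - F x₀` at a feasible `x` then dominates two
terms: the sum of the blockwise gaps in `l ≤ H`, and a multiple of `‖A x - b‖ ^ 2` from strong
convexity of `q`, where `r > 0` is essential.

Because the Euclidean ball is round, the contact set of each block lies on a single ray, and the gap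
controls the squared distance to it (`IsClosedGauge.exists_ray`). Thus `x` is close to the
polyhedral cone spanned by these rays, and `A x` is close to `b`. A Hoffman-type bound
(`exists_polyhedral_error_bound`) moves the approximating cone point onto the fibre of `A` over `b`,
and every cone point in that fibre is a minimizer. -/

noncomputable section

namespace KLExp

/-! ### Error bound for polyhedra in standard form. -/

/-- Lipschitz-type error bound for the standard-form polyhedra `{t ≥ 0 | B t = B t₀}`. -/
theorem exists_polyhedral_error_bound {ι Z : Type*} [Fintype ι] [NormedAddCommGroup Z]
    [NormedSpace ℝ Z] (B : EuclideanSpace ℝ ι →L[ℝ] Z) :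
    ∃ C : ℝ, 0 ≤ C ∧ ∀ t t₀ : EuclideanSpace ℝ ι, (∀ i, 0 ≤ t i) → (∀ i, 0 ≤ t₀ i) →
      ∃ t' : EuclideanSpace ℝ ι, (∀ i, 0 ≤ t' i) ∧ B t' = B t₀ ∧
        ‖t' - t‖ ≤ C * ‖B t - B t₀‖ := by
  by_contra! hcon
  have hstep : ∀ k : ℕ, ∃ p t : EuclideanSpace ℝ ι, (∀ i, 0 ≤ t i) ∧ (∀ i, 0 ≤ p i) ∧
      (k : ℝ) * ‖B (p - t)‖ < ‖p - t‖ ∧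
      ∀ y : EuclideanSpace ℝ ι, (∀ i, 0 ≤ y i) → B y = B p → ‖p - t‖ ≤ ‖y - t‖ := by
    intro k
    obtain ⟨t, t₀, ht, ht₀, h⟩ := hcon k k.cast_nonneg
    have hcl : IsClosed {y : EuclideanSpace ℝ ι | (∀ i, 0 ≤ y i) ∧ B y = B t₀} := by
      convert (isClosed_iInter fun i : ι => isClosed_le (continuous_const (y := (0 : ℝ)))
        (by fun_prop : Continuous fun y : EuclideanSpace ℝ ι => y i)).inter
        (isClosed_eq B.continuous (continuous_const (y := B t₀))) using 1
      ext y
      simp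
    -- A counterexample to the constant `k` is replaced by the pair of `t` and its nearest point `p`
    -- in the polyhedron.
    obtain ⟨p, ⟨hp0, hpB⟩, hp⟩ := hcl.exists_infDist_eq_dist ⟨t₀, ht₀, rfl⟩ t
    refine ⟨p, t, ht, hp0, ?_, fun y hy hyB => ?_⟩
    · have := h p hp0 hpB
      rwa [← hpB, norm_sub_rev (B t), ← map_sub] at this
    · have h1 : dist t p ≤ dist t y := hp ▸ Metric.infDist_le_dist_of_mem ⟨hy, hyB.trans hpB⟩
      rwa [dist_comm, dist_comm t, dist_eq_norm, dist_eq_norm] at h1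
  choose p t ht hp hlt hmin using hstep
  have hpos : ∀ k, 0 < ‖p k - t k‖ := fun k =>
    lt_of_le_of_lt (by positivity) (hlt k)
  set e : ℕ → EuclideanSpace ℝ ι := fun k => ‖p k - t k‖⁻¹ • (p k - t k) with he
  have hd : ∀ k, p k - t k = ‖p k - t k‖ • e k := fun k => by
    rw [he, smul_inv_smul₀ (hpos k).ne']
  have he1 : ∀ k, ‖e k‖ = 1 := fun k => by
    simp only [he, norm_smul, norm_inv, norm_norm]
    exact inv_mul_cancel₀ (hpos k).ne'
  obtain ⟨u, hu, φ, hφ, hlim⟩ := (isCompact_sphere (0 : EuclideanSpace ℝ ι) 1).tendsto_subseq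
    (x := e) (fun k => by simp [he1])
  -- The unit directions `e` satisfy `k * ‖B (e k)‖ < 1`, so the limit direction lies in the kernel.
  have hBu : B u = 0 := by
    have h1 : Tendsto (fun k => B (e (φ k))) atTop (𝓝 (B u)) :=
      (B.continuous.tendsto u).comp hlim
    refine tendsto_nhds_unique h1 (squeeze_zero_norm' (a := fun k : ℕ => (k : ℝ)⁻¹) ?_
      tendsto_inv_atTop_nhds_zero_nat)
    filter_upwards [eventually_gt_atTop 0] with k hk
    have hk' : (0 : ℝ) < k := by exact_mod_cast hk
    have h2 := hlt (φ k)
    rw [hd, map_smul, norm_smul, norm_norm, norm_smul, norm_norm, he1, mul_left_comm] at h2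
    have h3 : (φ k : ℝ) * ‖B (e (φ k))‖ < 1 := lt_of_mul_lt_mul_left h2 (hpos _).le
    have h4 : (k : ℝ) ≤ φ k := by exact_mod_cast hφ.id_le k
    rw [← one_div, le_div_iff₀ hk', mul_comm]
    exact (mul_le_mul_of_nonneg_right h4 (norm_nonneg _)).trans h3.le
  have hev : ∀ᶠ k in atTop, ∀ i, 0 < u i → u i / 2 < e (φ k) i := by
    refine eventually_all.2 fun i => ?_
    by_cases hi : 0 < u i
    · have h1 : Tendsto (fun k => e (φ k) i) atTop (𝓝 (u i)) :=
        ((by fun_prop : Continuous fun z : EuclideanSpace ℝ ι => z i).tendsto u).comp hlim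
      filter_upwards [h1.eventually (lt_mem_nhds (half_lt_self hi))] with k hk _ using hk
    · exact Eventually.of_forall fun k h => absurd h hi
  have hev2 : ∀ᶠ k in atTop, ‖e (φ k) - u‖ < 1 := by
    have := hlim.eventually (Metric.ball_mem_nhds u one_pos)
    filter_upwards [this] with k hk
    simpa [dist_eq_norm] using hk
  obtain ⟨k, hk1, hk2⟩ := (hev.and hev2).exists
  set c := ‖p (φ k) - t (φ k)‖ with hc
  have hcpos : 0 < c := hpos _
  -- Moving `p` back by `(c / 2) • u` stays in the polyhedron: where `u i > 0`, `p i ≥ c * e i > c *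
  -- u i / 2`. Since `e` is within distance 1 of `u`, the new point is closer to `t` than `p`, a
  -- contradiction.
  have hle := hmin (φ k) (p (φ k) - (c / 2) • u) (fun i => ?_) (by simp [hBu])
  · have h1 : p (φ k) - (c / 2) • u - t (φ k) =
        (c / 2) • (e (φ k) - u) + (c / 2) • e (φ k) := by
      have : p (φ k) - t (φ k) = c • e (φ k) := hd _
      rw [sub_right_comm, this]
      module
    have h2 := norm_add_le ((c / 2) • (e (φ k) - u)) ((c / 2) • e (φ k))
    rw [← h1, norm_smul, norm_smul, he1, Real.norm_of_nonneg (by positivity)] at h2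
    nlinarith
  · have h1 : p (φ k) i - t (φ k) i = c * e (φ k) i := by
      simpa using congrArg (fun z : EuclideanSpace ℝ ι => z i) (hd (φ k))
    have h2 := ht (φ k) i
    have h3 := hp (φ k) i
    simp only [PiLp.sub_apply, PiLp.smul_apply, smul_eq_mul]
    rcases le_or_gt (u i) 0 with h | h
    · nlinarith
    · nlinarith [hk1 i h]

/-! ### Closed gauges and contact rays. -/

theorem IsClosedGauge.toReal_smul {V : Type*} [NormedAddCommGroup V] [InnerProductSpace ℝ V]
    {κ : V → EReal} (hκ : IsClosedGauge κ) {t : ℝ} (ht : 0 < t) (u : V) :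
    (κ (t • u)).toReal = t * (κ u).toReal := by
  rw [hκ.pos_homogeneous t u ht, EReal.toReal_mul, EReal.toReal_coe]

theorem IsClosedGauge.coe_toReal {V : Type*} [NormedAddCommGroup V] [InnerProductSpace ℝ V]
    {κ : V → EReal} (hκ : IsClosedGauge κ) {u : V} (hu : κ u < ⊤) :
    ((κ u).toReal : EReal) = κ u :=
  EReal.coe_toReal hu.ne (lt_of_lt_of_le EReal.bot_lt_zero (hκ.nonneg u)).ne'

theorem IsClosedGauge.smul_lt_top {V : Type*} [NormedAddCommGroup V] [InnerProductSpace ℝ V]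
    {κ : V → EReal} (hκ : IsClosedGauge κ) {t : ℝ} (ht : 0 ≤ t) {u : V} (hu : κ u < ⊤) :
    κ (t • u) < ⊤ := by
  rcases ht.eq_or_lt with rfl | ht
  · rw [zero_smul, hκ.map_zero]; exact EReal.zero_lt_top
  · rw [hκ.pos_homogeneous t u ht, ← hκ.coe_toReal hu, ← EReal.coe_mul]
    exact EReal.coe_lt_top _

theorem IsClosedGauge.convexOn {V : Type*} [NormedAddCommGroup V] [InnerProductSpace ℝ V]
    {κ : V → EReal} (hκ : IsClosedGauge κ) :
    ConvexOn ℝ (dom κ) (fun u => (κ u).toReal) := by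
  have key : ∀ ⦃u⦄, u ∈ dom κ → ∀ ⦃v⦄, v ∈ dom κ → ∀ ⦃a b : ℝ⦄, 0 ≤ a → 0 ≤ b → a + b = 1 →
      κ (a • u + b • v) ≤ ((a * (κ u).toReal + b * (κ v).toReal : ℝ) : EReal) := by
    intro u hu v hv a b ha hb hab
    have := hκ.convex (x := (u, (κ u).toReal)) (hκ.coe_toReal hu).ge
      (y := (v, (κ v).toReal)) (hκ.coe_toReal hv).ge ha hb hab
    simpa using this
  refine ⟨fun u hu v hv a b ha hb hab =>
    (key hu hv ha hb hab).trans_lt (EReal.coe_lt_top _), fun u hu v hv a b ha hb hab => ?_⟩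
  have h := key hu hv ha hb hab
  have h2 : κ (a • u + b • v) < ⊤ := h.trans_lt (EReal.coe_lt_top _)
  rw [← hκ.coe_toReal h2] at h
  simpa using EReal.coe_le_coe_iff.1 h

/-- A gauge is subadditive on its effective domain. -/
theorem IsClosedGauge.add_lt_top_and_le {V : Type*} [NormedAddCommGroup V]
    [InnerProductSpace ℝ V] {κ : V → EReal} (hκ : IsClosedGauge κ) {u v : V} (hu : κ u < ⊤)
    (hv : κ v < ⊤) : κ (u + v) < ⊤ ∧ (κ (u + v)).toReal ≤ (κ u).toReal + (κ v).toReal := by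
  have h2 : (0 : ℝ) < 1 / 2 := by norm_num
  have hmem := hκ.convexOn.1 hu hv h2.le h2.le (by norm_num)
  have hle := hκ.convexOn.2 hu hv h2.le h2.le (by norm_num)
  have e : u + v = (2 : ℝ) • ((1 / 2 : ℝ) • u + (1 / 2 : ℝ) • v) := by module
  rw [e]
  refine ⟨hκ.smul_lt_top two_pos.le hmem, ?_⟩
  rw [hκ.toReal_smul two_pos]
  simp only [smul_eq_mul] at hle
  linarith

/-- If `‖u‖ + κ u` dominates the linear functional `ℓ`, then the contact set is contained in the
ray spanned by some `w`, and the excess controls the squared distance to that ray. -/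
theorem IsClosedGauge.exists_ray {V : Type*} [NormedAddCommGroup V] [InnerProductSpace ℝ V]
    [FiniteDimensional ℝ V] {κ : V → EReal} (hκ : IsClosedGauge κ) (l : V →L[ℝ] ℝ)
    (hl : ∀ u, κ u < ⊤ → l u ≤ ‖u‖ + (κ u).toReal) :
    ∃ w, κ w < ⊤ ∧ ‖w‖ + (κ w).toReal = l w ∧ ∃ C : ℝ, 0 ≤ C ∧ ∀ u, κ u < ⊤ →
      ‖u - ‖u‖ • w‖ ^ 2 ≤ C * (‖u‖ * (‖u‖ + (κ u).toReal - l u)) := by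
  by_cases hw : ∃ w, ‖w‖ = 1 ∧ κ w < ⊤ ∧ ‖w‖ + (κ w).toReal = l w
  · obtain ⟨w, hw1, hwt, hwl⟩ := hw
    refine ⟨w, hwt, hwl, 2, two_pos.le, fun u hu => ?_⟩
    -- First-order optimality of the contact point `w`: test the domination at `w + t • u`, use
    -- subadditivity of `κ`, divide by `t` and let `t` tend to 0.
    have hin : l u - inner ℝ w u ≤ (κ u).toReal := by
      have hstep : ∀ t : ℝ, 0 < t →
          0 ≤ (inner ℝ w u + (κ u).toReal - l u) + t * (‖u‖ ^ 2 / 2) := by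
        intro t ht
        obtain ⟨h1, h2⟩ := hκ.add_lt_top_and_le hwt (hκ.smul_lt_top ht.le hu)
        rw [hκ.toReal_smul ht] at h2
        have h3 := hl _ h1
        rw [map_add, map_smul, smul_eq_mul] at h3
        have h4 : ‖w + t • u‖ ^ 2 = 1 + 2 * (t * inner ℝ w u) + t ^ 2 * ‖u‖ ^ 2 := by
          rw [norm_add_sq_real, hw1, inner_smul_right, norm_smul, mul_pow, Real.norm_eq_abs,
            sq_abs]
          ring
        have h5 : ‖w + t • u‖ ≤ 1 + t * inner ℝ w u + t ^ 2 * ‖u‖ ^ 2 / 2 := by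
          nlinarith [sq_nonneg (‖w + t • u‖ - 1)]
        rw [hw1] at hwl
        have h6 : 0 ≤ t * ((inner ℝ w u + (κ u).toReal - l u) + t * (‖u‖ ^ 2 / 2)) := by
          nlinarith
        exact nonneg_of_mul_nonneg_right h6 ht
      have hlim : Tendsto (fun t : ℝ => (inner ℝ w u + (κ u).toReal - l u) + t * (‖u‖ ^ 2 / 2))
          (𝓝[>] 0) (𝓝 ((inner ℝ w u + (κ u).toReal - l u) + 0 * (‖u‖ ^ 2 / 2))) :=
        tendsto_nhdsWithin_of_tendsto_nhds (Continuous.tendsto (by fun_prop) 0)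
      have := ge_of_tendsto hlim (eventually_mem_nhdsWithin.mono fun t ht => hstep t ht)
      linarith
    have h1 : ‖u - ‖u‖ • w‖ ^ 2 = 2 * (‖u‖ * (‖u‖ - inner ℝ w u)) := by
      rw [norm_sub_sq_real, inner_smul_right, norm_smul, hw1, norm_norm, real_inner_comm]
      ring
    rw [h1]
    have := norm_nonneg u
    exact mul_le_mul_of_nonneg_left (mul_le_mul_of_nonneg_left (by linarith) this) two_pos.le
  · push Not at hw
    have h0 : κ 0 < ⊤ := by rw [hκ.map_zero]; exact EReal.zero_lt_top
    refine ⟨0, h0, by simp [hκ.map_zero], ?_⟩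
    -- Without a unit contact point the excess is positive on the unit sphere where `κ` is finite;
    -- by compactness and lower semicontinuity it is bounded below there, and homogeneity extends
    -- the bound with the trivial ray `w = 0`.
    have hc : ∃ c : ℝ, 0 < c ∧ ∀ u, ‖u‖ = 1 → κ u < ⊤ → c ≤ ‖u‖ + (κ u).toReal - l u := by
      by_cases hne : ∃ u, ‖u‖ = 1 ∧ κ u < ⊤
      · obtain ⟨u₀, hu₀, hu₀t⟩ := hne
        have hlsc : LowerSemicontinuous fun u => κ u + ((‖u‖ - l u : ℝ) : EReal) := by
          refine LowerSemicontinuous.add' hκ.closed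
            (continuous_coe_real_ereal.comp (by fun_prop)).lowerSemicontinuous fun u => ?_
          exact EReal.continuousAt_add (Or.inr (EReal.coe_ne_bot _)) (Or.inr (EReal.coe_ne_top _))
        obtain ⟨v, hv, hmin⟩ := (hlsc.lowerSemicontinuousOn _).exists_isMinOn
          ⟨u₀, by simpa using hu₀⟩ (isCompact_sphere (0 : V) 1)
        have hv1 : ‖v‖ = 1 := by simpa using hv
        have hcast : ∀ u, κ u < ⊤ → κ u + ((‖u‖ - l u : ℝ) : EReal) =
            ((‖u‖ + (κ u).toReal - l u : ℝ) : EReal) := fun u hu => by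
          conv_lhs => rw [← hκ.coe_toReal hu]
          rw [← EReal.coe_add]; congr 1; ring
        have hvt : κ v < ⊤ := by
          have h1 := hmin (show u₀ ∈ Metric.sphere (0 : V) 1 by simpa using hu₀)
          simp only [Set.mem_ofPred_eq, hcast u₀ hu₀t] at h1
          by_contra h
          rw [not_lt_top_iff.1 h, EReal.top_add_coe] at h1
          exact absurd h1 (not_le.2 (EReal.coe_lt_top _))
        refine ⟨‖v‖ + (κ v).toReal - l v, ?_, fun u hu hut => ?_⟩
        · have := hl v hvt
          have := hw v hv1 hvt
          exact sub_pos.2 (lt_of_le_of_ne ‹_› this.symm)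
        · have h1 := hmin (show u ∈ Metric.sphere (0 : V) 1 by simpa using hu)
          simp only [Set.mem_ofPred_eq, hcast u hut, hcast v hvt] at h1
          exact EReal.coe_le_coe_iff.1 h1
      · push Not at hne
        exact ⟨1, one_pos, fun u hu hut => absurd hut (not_lt.2 (hne u hu))⟩
    obtain ⟨c, hc0, hc⟩ := hc
    refine ⟨c⁻¹, by positivity, fun u hu => ?_⟩
    rw [smul_zero, sub_zero]
    rcases eq_or_ne u 0 with rfl | hu0
    · simp
    have hn : 0 < ‖u‖ := norm_pos_iff.2 hu0
    have h1 := hc (‖u‖⁻¹ • u) (by rw [norm_smul, norm_inv, norm_norm, inv_mul_cancel₀ hn.ne'])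
      (hκ.smul_lt_top (by positivity) hu)
    rw [hκ.toReal_smul (by positivity), norm_smul, norm_inv, norm_norm, map_smul, smul_eq_mul,
      ← mul_add, ← mul_sub, le_inv_mul_iff₀ hn] at h1
    rw [le_inv_mul_iff₀ hc0]
    nlinarith

/-! ### Convex subgradients, and the KL exponent from quadratic growth. -/

section Subgradients

variable {E : Type*} [NormedAddCommGroup E] [InnerProductSpace ℝ E]

/-- Along the segment towards `y`, convexity bounds every difference quotient by the constant `c`;
points of the segment accumulate at `x`, so the nonnegative liminf is at most `c`. -/
theorem regularSubdiff_le {f : E → EReal} (hbot : ∀ x, ⊥ < f x)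
    (hconv : ConvexOn ℝ (dom f) fun x => (f x).toReal) {x v : E} (hv : v ∈ regularSubdiff f x)
    {y : E} (hy : y ∈ dom f) : (f x).toReal + inner ℝ v (y - x) ≤ (f y).toReal := by
  obtain ⟨hx, hlim⟩ := hv
  have hcoe : ∀ z ∈ dom f, f z = ((f z).toReal : EReal) := fun z hz =>
    (EReal.coe_toReal (ne_of_lt hz) (hbot z).ne').symm
  rcases eq_or_ne y x with rfl | hne
  · simp
  have hd : 0 < ‖y - x‖ := norm_pos_iff.2 (sub_ne_zero.2 hne)
  set c : ℝ := ((f y).toReal - (f x).toReal - inner ℝ v (y - x)) / ‖y - x‖ with hc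
  suffices h : 0 ≤ c by
    rw [hc, le_div_iff₀ hd] at h
    linarith
  have hle : liminf (fun z : E => (f z - f x - ((inner ℝ v (z - x) : ℝ) : EReal)) /
      ((‖z - x‖ : ℝ) : EReal)) (𝓝[≠] x) ≤ (c : EReal) := by
    refine liminf_le_of_frequently_le ?_ (by isBoundedDefault)
    have htend : Tendsto (fun t : ℝ => x + t • (y - x)) (𝓝[>] 0) (𝓝[≠] x) := by
      refine tendsto_nhdsWithin_iff.2 ⟨?_, ?_⟩
      · have : Continuous fun t : ℝ => x + t • (y - x) := by fun_prop
        simpa using (this.tendsto 0).mono_left nhdsWithin_le_nhds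
      · filter_upwards [self_mem_nhdsWithin] with t ht
        simpa [(show (0 : ℝ) < t from ht).ne', sub_eq_zero] using hne
    refine htend.frequently (Eventually.frequently ?_)
    filter_upwards [Ioo_mem_nhdsGT (one_pos : (0 : ℝ) < 1)] with t ht
    have hz : x + t • (y - x) = (1 - t) • x + t • y := by module
    have h1 : x + t • (y - x) ∈ dom f :=
      hz ▸ hconv.1 hx hy (sub_nonneg.2 ht.2.le) ht.1.le (by ring)
    have h2 : (f (x + t • (y - x))).toReal ≤ (1 - t) * (f x).toReal + t * (f y).toReal :=
      hz ▸ hconv.2 hx hy (sub_nonneg.2 ht.2.le) ht.1.le (by ring)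
    rw [hcoe _ h1, hcoe _ hx, ← EReal.coe_sub, ← EReal.coe_sub, ← EReal.coe_div,
      EReal.coe_le_coe_iff, add_sub_cancel_left, inner_smul_right, norm_smul,
      Real.norm_of_nonneg ht.1.le, hc, div_le_div_iff₀ (mul_pos ht.1 hd) hd]
    nlinarith
  exact EReal.coe_nonneg.1 (hlim.trans hle)

/-- Limiting subgradients of a convex function are global subgradients. -/
theorem subdiff_le {f : E → EReal} (hbot : ∀ x, ⊥ < f x)
    (hconv : ConvexOn ℝ (dom f) fun x => (f x).toReal) {x v : E} (hv : v ∈ subdiff f x)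
    {y : E} (hy : y ∈ dom f) : (f x).toReal + inner ℝ v (y - x) ≤ (f y).toReal := by
  obtain ⟨hx, xs, vs, hxs, hfxs, hvs, hvlim⟩ := hv
  have h1 : Tendsto (fun k => (f (xs k)).toReal) atTop (𝓝 (f x).toReal) :=
    (EReal.tendsto_toReal (ne_of_lt hx) (hbot x).ne').comp hfxs
  have h2 : Tendsto (fun k => (f (xs k)).toReal + inner ℝ (vs k) (y - xs k)) atTop
      (𝓝 ((f x).toReal + inner ℝ v (y - x))) :=
    h1.add (hvlim.inner (tendsto_const_nhds.sub hxs))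
  exact le_of_tendsto' h2 fun k => regularSubdiff_le hbot hconv (hvs k) hy

/-- Sufficient condition for the KL property with exponent `1/2`, in terms of individual
subgradients. -/
theorem hasKLExponentAt_half {f : E → EReal} (hbot : ∀ x, ⊥ < f x) {x₀ : E} (hx₀ : x₀ ∈ dom f)
    {a₀ : ℝ} (ha₀ : 0 < a₀) {V : Set E} (hV : V ∈ 𝓝 x₀)
    (h : ∀ x ∈ V, x ∈ dom f → (f x₀).toReal < (f x).toReal → (f x).toReal < (f x₀).toReal + 1 →
      ∀ v ∈ subdiff f x, 2 * √((f x).toReal - (f x₀).toReal) ≤ a₀ * ‖v‖) :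
    HasKLExponentAt f x₀ (1 / 2) := by
  have hcoe : ∀ z ∈ dom f, f z = ((f z).toReal : EReal) := fun z hz =>
    (EReal.coe_toReal (ne_of_lt hz) (hbot z).ne').symm
  have hexp : (1 - 1 / 2 : ℝ) = 1 / 2 := by norm_num
  have hderiv : ∀ ν : ℝ, 0 < ν →
      deriv (fun ν : ℝ => a₀ * ν ^ (1 - 1 / 2 : ℝ)) ν = a₀ / (2 * √ν) := by
    intro ν hν
    have h1 : (fun ν : ℝ => a₀ * ν ^ (1 - 1 / 2 : ℝ)) = fun ν => a₀ * √ν := by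
      funext ν; rw [hexp, Real.sqrt_eq_rpow]
    rw [h1, ((Real.hasDerivAt_sqrt hν.ne').const_mul a₀).deriv]
    ring
  have hcont : Continuous fun ν : ℝ => a₀ * ν ^ (1 - 1 / 2 : ℝ) :=
    continuous_const.mul (Real.continuous_rpow_const (by norm_num))
  -- The level bound is taken to be 1, matching the `+ 1` in the hypothesis `h`.
  refine ⟨1, a₀, ha₀, one_pos, ?_, fun ν hν _ => by positivity, hcont.continuousOn, ?_, ?_, ?_,
    V, hV, ?_⟩
  · simp only [hexp]
    rw [Real.zero_rpow (by norm_num), mul_zero]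
  · have h1 : ConcaveOn ℝ (Set.Ici 0) fun ν : ℝ => a₀ * ν ^ (1 - 1 / 2 : ℝ) :=
      (Real.concaveOn_rpow (by norm_num) (by norm_num)).smul ha₀.le
    have h2 : {ν : ℝ | 0 ≤ ν ∧ (ν : EReal) < 1} = Set.Ico 0 1 := by
      ext ν
      exact and_congr_right fun _ => EReal.coe_lt_coe_iff (x := ν) (y := 1)
    rw [h2]
    exact h1.subset Set.Ico_subset_Ici_self (convex_Ico 0 1)
  · intro ν hν
    exact (contDiffAt_const.mul
      (Real.contDiffAt_rpow_const_of_ne (hν.1).ne')).contDiffWithinAt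
  · intro ν hν _
    rw [hderiv ν hν]
    positivity
  · intro x hxV hlt hlt1
    have hx : x ∈ dom f := hlt1.trans_le le_top
    rw [hcoe x hx, hcoe x₀ hx₀, EReal.coe_lt_coe_iff] at hlt
    rw [hcoe x hx, hcoe x₀ hx₀, ← EReal.coe_one, ← EReal.coe_add, EReal.coe_lt_coe_iff] at hlt1
    have hν : 0 < (f x).toReal - (f x₀).toReal := sub_pos.2 hlt
    rw [hcoe x hx, hcoe x₀ hx₀, ← EReal.coe_sub, EReal.toReal_coe, hderiv _ hν]
    set r := √((f x).toReal - (f x₀).toReal) with hr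
    have hr0 : 0 < r := Real.sqrt_pos.2 hν
    have hle : ENNReal.ofReal (2 * r / a₀) ≤ Metric.infEDist 0 (subdiff f x) := by
      refine Metric.le_infEDist.2 fun v hv => ?_
      rw [edist_dist, dist_zero_left]
      refine ENNReal.ofReal_le_ofReal ?_
      rw [div_le_iff₀ ha₀, mul_comm ‖v‖]
      exact h x hxV hx hlt hlt1 v hv
    refine le_trans ?_ (mul_le_mul_right hle _)
    rw [← ENNReal.ofReal_mul (by positivity), ENNReal.one_le_ofReal]
    field_simp
    exact le_rfl

/-- A convex function that satisfies a quadratic growth condition near each of its minimizers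
has the KL exponent `1/2` at every point of its domain. -/
theorem hasKLExponentAt_half_of_growth {f : E → EReal} (hbot : ∀ x, ⊥ < f x)
    (hconv : ConvexOn ℝ (dom f) fun x => (f x).toReal) {x₀ : E} (hx₀ : x₀ ∈ dom f)
    (hgrowth : (∀ x ∈ dom f, (f x₀).toReal ≤ (f x).toReal) → ∃ C : ℝ, 0 < C ∧
      ∀ x ∈ dom f, ‖x - x₀‖ ≤ 1 → ∃ x' ∈ dom f, (f x').toReal = (f x₀).toReal ∧
        ‖x - x'‖ ^ 2 ≤ C * ((f x).toReal - (f x₀).toReal)) :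
    HasKLExponentAt f x₀ (1 / 2) := by
  -- At a minimizer, the subgradient inequality at `x'` and growth give `ν ≤ ‖v‖ * ‖x - x'‖ ≤ ‖v‖ *
  -- √C * √ν`; dividing by `√ν` yields the claim.
  by_cases hmin : ∀ x ∈ dom f, (f x₀).toReal ≤ (f x).toReal
  · obtain ⟨C, hC, hg⟩ := hgrowth hmin
    refine hasKLExponentAt_half hbot hx₀ (a₀ := 2 * √C) (by positivity)
      (Metric.closedBall_mem_nhds x₀ one_pos) fun x hxV hx hlt _ v hv => ?_
    obtain ⟨x', hx', heq, hle⟩ := hg x hx (by simpa [dist_eq_norm] using hxV)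
    have h1 := subdiff_le hbot hconv hv hx'
    have h2 : (f x).toReal - (f x₀).toReal ≤ ‖v‖ * ‖x - x'‖ := by
      have := neg_le_of_abs_le (abs_real_inner_le_norm v (x' - x))
      rw [norm_sub_rev x' x] at this
      linarith
    have hν : 0 < (f x).toReal - (f x₀).toReal := sub_pos.2 hlt
    set ν := (f x).toReal - (f x₀).toReal with hνdef
    have h3 : ‖x - x'‖ ≤ √C * √ν := by
      rw [← Real.sqrt_mul hC.le]
      exact Real.le_sqrt_of_sq_le hle
    have h4 : √ν * √ν = ν := Real.mul_self_sqrt hν.le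
    have h5 : √ν * √ν ≤ (√C * ‖v‖) * √ν := by
      rw [h4]
      calc ν ≤ ‖v‖ * ‖x - x'‖ := h2
        _ ≤ ‖v‖ * (√C * √ν) := by gcongr
        _ = _ := by ring
    have := le_of_mul_le_mul_right h5 (Real.sqrt_pos.2 hν)
    linarith
  -- A point `y` lying lower by `δ` forces `‖v‖ ≥ δ / (‖y - x₀‖ + 1)` on the unit ball, while the
  -- level bound keeps `√ν ≤ 1`.
  · push Not at hmin
    obtain ⟨y, hy, hlt⟩ := hmin
    set δ := (f x₀).toReal - (f y).toReal with hδ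
    have hδ0 : 0 < δ := sub_pos.2 hlt
    have hR : 0 < ‖y - x₀‖ + 1 := by positivity
    refine hasKLExponentAt_half hbot hx₀ (a₀ := 2 * (‖y - x₀‖ + 1) / δ) (by positivity)
      (Metric.closedBall_mem_nhds x₀ one_pos) fun x hxV hx hltx hltx1 v hv => ?_
    have hxx : ‖x₀ - x‖ ≤ 1 := by
      rw [norm_sub_rev]; simpa [dist_eq_norm] using hxV
    have h1 := subdiff_le hbot hconv hv hy
    have h2 : δ ≤ ‖v‖ * (‖y - x₀‖ + 1) := by
      have h3 := neg_le_of_abs_le (abs_real_inner_le_norm v (y - x))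
      have h4 : ‖y - x‖ ≤ ‖y - x₀‖ + 1 := by
        have := norm_add_le (y - x₀) (x₀ - x)
        rw [sub_add_sub_cancel] at this
        linarith
      have h5 := mul_le_mul_of_nonneg_left h4 (norm_nonneg v)
      linarith
    have h6 : √((f x).toReal - (f x₀).toReal) ≤ 1 := by
      rw [Real.sqrt_le_one]
      linarith
    have h7 : 2 * (‖y - x₀‖ + 1) / δ * ‖v‖ = 2 * ((‖v‖ * (‖y - x₀‖ + 1)) / δ) := by ring
    rw [h7]
    have h8 : 1 ≤ (‖v‖ * (‖y - x₀‖ + 1)) / δ := (one_le_div hδ0).2 h2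
    linarith

end Subgradients

/-! ### Strong convexity and the Lagrange multiplier. -/

theorem fderiv_apply_le_of_quadratic_bound {E : Type*} [NormedAddCommGroup E] [NormedSpace ℝ E]
    {f : E → ℝ} {f' : E →L[ℝ] ℝ} {b d : E} (hf : HasFDerivAt f f' b) {c k : ℝ}
    (h : ∀ t ∈ Set.Ioo (0 : ℝ) 1, f (b + t • d) ≤ f b + t * c + t ^ 2 * k) : f' d ≤ c := by
  have h1 : Tendsto (fun t : ℝ => t⁻¹ • (f (b + t • d) - f b)) (𝓝[>] 0)
      (𝓝 (f' d)) := (hf.hasLineDerivAt d).tendsto_slope_zero_right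
  have h2 : Tendsto (fun t : ℝ => c + t * k) (𝓝[>] 0) (𝓝 (c + 0 * k)) :=
    tendsto_nhdsWithin_of_tendsto_nhds (Continuous.tendsto (by fun_prop) 0)
  have h3 := le_of_tendsto_of_tendsto h1 h2 (by
    filter_upwards [Ioo_mem_nhdsGT (one_pos : (0 : ℝ) < 1)] with t ht
    have := h t ht
    rw [smul_eq_mul, inv_mul_le_iff₀ ht.1]
    nlinarith)
  simpa using h3

theorem add_fderiv_le_of_strongConvexOn {E : Type*} [NormedAddCommGroup E] [NormedSpace ℝ E]
    {K : Set E} {m : ℝ} {q : E → ℝ} (hq : StrongConvexOn K m q) {b z : E} (hb : b ∈ K)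
    (hz : z ∈ K) {q' : E →L[ℝ] ℝ} (hq' : HasFDerivAt q q' b) :
    q b + q' (z - b) + m / 2 * ‖z - b‖ ^ 2 ≤ q z := by
  have h := fderiv_apply_le_of_quadratic_bound hq' (d := z - b)
    (c := q z - q b - m / 2 * ‖z - b‖ ^ 2) (k := m / 2 * ‖z - b‖ ^ 2) fun t ht => by
      have h1 := hq.2 hz hb ht.1.le (sub_nonneg.2 ht.2.le) (by ring)
      have h2 : t • z + (1 - t) • b = b + t • (z - b) := by module
      rw [h2] at h1
      simp only [smul_eq_mul] at h1
      linarith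
  linarith

/-- Convexity involves two points at a time, and any two points lie in a common closed ball. -/
theorem LocallyStronglyConvexC2.convexOn {E : Type*} [NormedAddCommGroup E]
    [InnerProductSpace ℝ E] [FiniteDimensional ℝ E] {q : E → ℝ}
    (hq : LocallyStronglyConvexC2 q) : ConvexOn ℝ Set.univ q := by
  refine ⟨convex_univ, fun x _ y _ a b ha hb hab => ?_⟩
  obtain ⟨m, hm, hqm⟩ := hq.strongConvexOn (Metric.closedBall 0 (max ‖x‖ ‖y‖))
    (isCompact_closedBall _ _) (convex_closedBall _ _)
  exact (UniformConvexOn.convexOn hqm fun _ => by positivity).2 (by simp) (by simp) ha hb hab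

/-- Lagrange multiplier for one convex constraint under the Slater condition; the multiplier is
positive when some infeasible point has a smaller objective value. -/
theorem exists_pos_multiplier {E : Type*} [AddCommGroup E] [Module ℝ E] {D : Set E}
    {H g : E → ℝ} (hH : ConvexOn ℝ D H) (hg : ConvexOn ℝ D g) {μ : ℝ}
    (hmin : ∀ x ∈ D, g x ≤ 0 → μ ≤ H x) {y : E} (hy : y ∈ D) (hgy : g y < 0) {z : E}
    (hz : z ∈ D) (hgz : 0 < g z) (hHz : H z < μ) :
    ∃ r : ℝ, 0 < r ∧ ∀ x ∈ D, μ ≤ H x + r * g x := by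
  -- The segment from `x` to `y` contains a point where the convex bound for `g` is zero; that point
  -- is feasible, so `H` is at least `μ` there.
  have key : ∀ x ∈ D, 0 < g x → ∀ y ∈ D, g y < 0 →
      (μ - H x) / g x ≤ (H y - μ) / (-g y) := by
    intro x hx hgx y hy hgy
    have hs : 0 < g x - g y := by linarith
    have ha : 0 ≤ -g y / (g x - g y) := div_nonneg (by linarith) hs.le
    have hb : 0 ≤ g x / (g x - g y) := div_nonneg hgx.le hs.le
    have hab : -g y / (g x - g y) + g x / (g x - g y) = 1 := by
      field_simp; ring
    have h1 := hg.2 hx hy ha hb hab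
    have h2 := hH.2 hx hy ha hb hab
    have h3 : -g y / (g x - g y) * g x + g x / (g x - g y) * g y = 0 := by ring
    simp only [smul_eq_mul] at h1 h2
    have h4 := (hmin _ (hH.1 hx hy ha hb hab) (h1.trans h3.le)).trans h2
    have h5 : -g y / (g x - g y) * H x + g x / (g x - g y) * H y =
        (-g y * H x + g x * H y) / (g x - g y) := by ring
    rw [h5, le_div_iff₀ hs] at h4
    rw [div_le_div_iff₀ hgx (by linarith)]
    nlinarith
  -- The multiplier is the supremum of the slopes demanded by infeasible points; the slopes allowed
  -- by strictly feasible points bound it above, and `z` makes it positive.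
  set T : Set ℝ := (fun x => (μ - H x) / g x) '' {x | x ∈ D ∧ 0 < g x} with hT
  have hne : T.Nonempty := ⟨_, z, ⟨hz, hgz⟩, rfl⟩
  have hub : ∀ y ∈ D, g y < 0 → (H y - μ) / (-g y) ∈ upperBounds T := by
    rintro y hy hgy _ ⟨x, ⟨hx, hgx⟩, rfl⟩
    exact key x hx hgx y hy hgy
  have hle : ∀ x ∈ D, 0 < g x → (μ - H x) / g x ≤ sSup T := fun x hx hgx =>
    le_csSup ⟨_, hub y hy hgy⟩ ⟨x, ⟨hx, hgx⟩, rfl⟩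
  refine ⟨sSup T, (div_pos (sub_pos.2 hHz) hgz).trans_le (hle z hz hgz), fun x hx => ?_⟩
  rcases lt_trichotomy (g x) 0 with h | h | h
  · have := csSup_le hne (hub x hx h)
    rw [le_div_iff₀ (by linarith)] at this
    linarith
  · rw [h, mul_zero, add_zero]
    exact hmin x hx h.le
  · have := hle x hx h
    rw [div_le_iff₀ h] at this
    linarith

/-! ### Quadratic growth for block sums of gauges. -/

section Blocks

variable {ι E Z : Type*} {V : ι → Type*} [NormedAddCommGroup E]
  [NormedSpace ℝ E] [NormedAddCommGroup Z] [InnerProductSpace ℝ Z]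
  [∀ i, NormedAddCommGroup (V i)] [∀ i, InnerProductSpace ℝ (V i)]

/-- The points all of whose blocks lie in the domains of the gauges. -/
def blockDom (π : ∀ i, E →L[ℝ] V i) (κ : ∀ i, V i → EReal) : Set E :=
  {x | ∀ i, κ i (π i x) < ⊤}

/-- The real-valued function `∑ i, (‖π i x‖ + κ i (π i x))`. -/
def blockSum [Fintype ι] (π : ∀ i, E →L[ℝ] V i) (κ : ∀ i, V i → EReal) (x : E) : ℝ :=
  ∑ i, (‖π i x‖ + (κ i (π i x)).toReal)

variable {π : ∀ i, E →L[ℝ] V i} {κ : ∀ i, V i → EReal}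

theorem convexOn_blockSum [Fintype ι] (hκ : ∀ i, IsClosedGauge (κ i)) :
    ConvexOn ℝ (blockDom π κ) (blockSum π κ) := by
  have hconv : Convex ℝ (blockDom π κ) := by
    intro x hx y hy a b ha hb hab i
    rw [map_add, map_smul, map_smul]
    exact (hκ i).convexOn.1 (hx i) (hy i) ha hb hab
  refine ⟨hconv, fun x hx y hy a b ha hb hab => ?_⟩
  simp only [blockSum, smul_eq_mul, Finset.mul_sum, ← Finset.sum_add_distrib]
  refine Finset.sum_le_sum fun i _ => ?_
  rw [map_add, map_smul, map_smul]
  have h1 := (hκ i).convexOn.2 (hx i) (hy i) ha hb hab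
  have h2 := norm_add_le (a • π i x) (b • π i y)
  rw [norm_smul, norm_smul, Real.norm_of_nonneg ha, Real.norm_of_nonneg hb] at h2
  simp only [smul_eq_mul] at h1
  linarith

theorem toReal_gauge_nonneg {U : Type*} [NormedAddCommGroup U] [InnerProductSpace ℝ U]
    {k : U → EReal} (hk : IsClosedGauge k) (u : U) : 0 ≤ (k u).toReal :=
  EReal.toReal_nonneg (hk.nonneg u)

theorem blockSum_nonneg [Fintype ι] (hκ : ∀ i, IsClosedGauge (κ i)) (x : E) :
    0 ≤ blockSum π κ x :=
  Finset.sum_nonneg fun i _ => add_nonneg (norm_nonneg _) (toReal_gauge_nonneg (hκ i) _)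

theorem zero_mem_blockDom (hκ : ∀ i, IsClosedGauge (κ i)) : (0 : E) ∈ blockDom π κ := fun i => by
  rw [map_zero, (hκ i).map_zero]; exact EReal.zero_lt_top

theorem blockSum_zero [Fintype ι] (hκ : ∀ i, IsClosedGauge (κ i)) :
    blockSum π κ (0 : E) = 0 :=
  Finset.sum_eq_zero fun i _ => by simp [(hκ i).map_zero]

/-- Quadratic growth of `∑ i, (‖π i x‖ + κ i (π i x))` over `{x | q (A x) ≤ 0}` around the set of
minimizers. -/
theorem exists_quadratic_growth [Fintype ι] [FiniteDimensional ℝ Z]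
    [∀ i, FiniteDimensional ℝ (V i)]
    {e : ∀ i, V i →L[ℝ] E} (hπe : ∀ i u, π i (e i u) = u)
    (hπe' : ∀ i j u, i ≠ j → π j (e i u) = 0) (hsum : ∀ x, ∑ i, e i (π i x) = x)
    (hκ : ∀ i, IsClosedGauge (κ i)) {q : Z → ℝ} (hq : LocallyStronglyConvexC2 q)
    (A : E →L[ℝ] Z) {y : E} (hy : y ∈ blockDom π κ) (hqy : q (A y) < 0) (hq0 : 0 < q 0)
    {x₀ : E} (hx₀ : x₀ ∈ blockDom π κ) (hqx₀ : q (A x₀) ≤ 0)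
    (hmin : ∀ x ∈ blockDom π κ, q (A x) ≤ 0 → blockSum π κ x₀ ≤ blockSum π κ x) :
    ∃ C : ℝ, 0 < C ∧ ∀ x ∈ blockDom π κ, q (A x) ≤ 0 → ‖x - x₀‖ ≤ 1 →
      ∃ x' ∈ blockDom π κ, q (A x') ≤ 0 ∧ blockSum π κ x' = blockSum π κ x₀ ∧
        ‖x - x'‖ ^ 2 ≤ C * (blockSum π κ x - blockSum π κ x₀) := by
  set D := blockDom π κ with hD
  set H := blockSum π κ with hH
  have hHconv : ConvexOn ℝ D H := convexOn_blockSum hκ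
  have h0D : (0 : E) ∈ D := zero_mem_blockDom hκ
  have hHx₀ : 0 < H x₀ := by
    refine lt_of_le_of_ne (blockSum_nonneg hκ _) fun h => ?_
    have h1 := (Finset.sum_eq_zero_iff_of_nonneg fun i _ =>
      add_nonneg (norm_nonneg _) (toReal_gauge_nonneg (hκ i) _)).1 h.symm
    have h2 : x₀ = 0 := by
      rw [← hsum x₀]
      refine Finset.sum_eq_zero fun i hi => ?_
      have h3 := h1 i hi
      have h4 : ‖π i x₀‖ = 0 := by
        have := toReal_gauge_nonneg (hκ i) (π i x₀)
        have := norm_nonneg (π i x₀)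
        linarith
      rw [norm_eq_zero.1 h4, map_zero]
    rw [h2, map_zero] at hqx₀
    exact absurd hq0 (not_lt.2 hqx₀)
  have hqA : ConvexOn ℝ D fun x => q (A x) :=
    (hq.convexOn.comp_linearMap (A : E →ₗ[ℝ] Z)).subset (Set.subset_univ _) hHconv.1
  -- The origin is the infeasible point of smaller value that makes the multiplier positive.
  obtain ⟨r, hr, hL⟩ := exists_pos_multiplier hHconv hqA hmin hy hqy h0D
    (by simpa using hq0) (by rw [hH, blockSum_zero hκ]; exact hHx₀)
  set b := A x₀ with hb
  -- Complementary slackness, from the multiplier inequality at `x₀` itself.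
  have hqb : q b = 0 := by
    refine le_antisymm hqx₀ ?_
    have := hL x₀ hx₀
    exact nonneg_of_mul_nonneg_right (by linarith : 0 ≤ r * q (A x₀)) hr
  set q' := fderiv ℝ q b
  have hq' : HasFDerivAt q q' b :=
    (hq.contDiff.differentiable (by norm_num) b).hasFDerivAt
  set l : E →L[ℝ] ℝ := -(r • (q'.comp A)) with hl
  have hlA : ∀ x, l x = -(r * q' (A x)) := fun x => by simp [hl]
  -- Linearizing `q ∘ A` at `x₀` in the multiplier inequality: `x₀` also minimizes `H - l`.
  have hfirst : ∀ x ∈ D, H x₀ - l x₀ ≤ H x - l x := by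
    intro x hx
    have h1 := fderiv_apply_le_of_quadratic_bound hq'.neg (d := A (x - x₀))
      (c := (H x - H x₀) / r) (k := 0) fun t ht => by
        have h2 : (1 - t) • x₀ + t • x = x₀ + t • (x - x₀) := by module
        have h3 := hHconv.1 hx₀ hx (sub_nonneg.2 ht.2.le) ht.1.le (by ring)
        have h4 := hHconv.2 hx₀ hx (sub_nonneg.2 ht.2.le) ht.1.le (by ring)
        rw [h2] at h3 h4
        have h5 := hL _ h3
        rw [map_add, map_smul, ← hb] at h5
        simp only [smul_eq_mul] at h4
        have h6 : -q (b + t • A (x - x₀)) ≤ (t * (H x - H x₀)) / r := by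
          rw [le_div_iff₀ hr]
          linarith
        simp only [Pi.neg_apply, hqb]
        rw [mul_div_assoc] at h6
        linarith
    rw [le_div_iff₀ hr, map_sub, neg_apply, map_sub] at h1
    rw [hlA, hlA]
    linarith
  -- `H - l` is positively homogeneous, so its minimal value is zero; the points `0` and `2 • x₀`
  -- suffice as tests.
  have hlx₀ : H x₀ = l x₀ := by
    have h1 := hfirst 0 h0D
    rw [map_zero, hH, blockSum_zero hκ, ← hH] at h1
    have h2 := hfirst ((2 : ℝ) • x₀) fun i => by
      rw [map_smul]; exact (hκ i).smul_lt_top two_pos.le (hx₀ i)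
    have h3 : H ((2 : ℝ) • x₀) = 2 * H x₀ := by
      simp only [hH, blockSum, Finset.mul_sum]
      refine Finset.sum_congr rfl fun i _ => ?_
      rw [map_smul, (hκ i).toReal_smul two_pos, norm_smul, Real.norm_of_nonneg two_pos.le]
      ring
    rw [h3, map_smul, smul_eq_mul] at h2
    linarith
  have hblock : ∀ i u, κ i u < ⊤ → (l.comp (e i)) u ≤ ‖u‖ + (κ i u).toReal := by
    intro i u hu
    have h1 : e i u ∈ D := fun j => by
      rcases eq_or_ne i j with rfl | hij
      · rwa [hπe]
      · rw [hπe' i j u hij, (hκ j).map_zero]; exact EReal.zero_lt_top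
    have h2 : H (e i u) = ‖u‖ + (κ i u).toReal := by
      rw [hH, blockSum, Finset.sum_eq_single i]
      · rw [hπe]
      · intro j _ hj
        rw [hπe' i j u hj.symm, (hκ j).map_zero]; simp
      · simp
    have h3 := hfirst _ h1
    rw [h2] at h3
    rw [ContinuousLinearMap.comp_apply]
    linarith
  choose w hwD hwl C hC0 hC using fun i => (hκ i).exists_ray (l.comp (e i)) (hblock i)
  set gap : ι → E → ℝ := fun i x => ‖π i x‖ + (κ i (π i x)).toReal - l (e i (π i x)) with hgap
  have hgap0 : ∀ i, ∀ x ∈ D, 0 ≤ gap i x := fun i x hx => sub_nonneg.2 (hblock i _ (hx i))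
  have hgapsum : ∀ x, ∑ i, gap i x = H x - l x := fun x => by
    rw [Finset.sum_sub_distrib, ← map_sum, hsum]
    rfl
  -- `W` parametrizes, by nonnegative `t`, the cone spanned by the contact rays, on which `H = l`.
  let W : EuclideanSpace ℝ ι →L[ℝ] E := ∑ i, (EuclideanSpace.proj i).smulRight (e i (w i))
  have hW : ∀ t, W t = ∑ i, t i • e i (w i) := fun t => by
    simp [W]
  have hπW : ∀ t j, π j (W t) = t j • w j := fun t j => by
    rw [hW, map_sum, Finset.sum_eq_single j]
    · rw [map_smul, hπe]
    · intro i _ hij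
      rw [map_smul, hπe' i j _ hij, smul_zero]
    · simp
  have hWD : ∀ t : EuclideanSpace ℝ ι, (∀ i, 0 ≤ t i) → W t ∈ D := fun t ht i => by
    rw [hπW]; exact (hκ i).smul_lt_top (ht i) (hwD i)
  have hHW : ∀ t : EuclideanSpace ℝ ι, (∀ i, 0 ≤ t i) → H (W t) = l (W t) := fun t ht => by
    rw [hW, map_sum, ← hW, hH, blockSum]
    refine Finset.sum_congr rfl fun i _ => ?_
    have h1 : (κ i (t i • w i)).toReal = t i * (κ i (w i)).toReal := by
      rcases (ht i).eq_or_lt with h | h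
      · simp [← h, (hκ i).map_zero]
      · exact (hκ i).toReal_smul h _
    have h2 := hwl i
    rw [ContinuousLinearMap.comp_apply] at h2
    rw [hπW, h1, norm_smul, Real.norm_of_nonneg (ht i), map_smul, smul_eq_mul, ← h2]
    ring
  -- Block norms are the ray coordinates in which `exists_ray` measures distance.
  let τ : E → EuclideanSpace ℝ ι := fun x => WithLp.toLp 2 fun i => ‖π i x‖
  have hτ0 : ∀ x i, 0 ≤ τ x i := fun x i => norm_nonneg _
  have hdiff : ∀ x, ‖x - W (τ x)‖ ≤ ∑ i, ‖e i‖ * ‖π i x - ‖π i x‖ • w i‖ := fun x => by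
    have h1 : x - W (τ x) = ∑ i, e i (π i x - ‖π i x‖ • w i) := by
      conv_lhs => rw [← hsum x]
      rw [hsum, hW]
      simp only [map_sub, map_smul, Finset.sum_sub_distrib, hsum]
      rfl
    rw [h1]
    exact (norm_sum_le _ _).trans (Finset.sum_le_sum fun i _ => (e i).le_opNorm _)
  have hray : ∀ x ∈ D, ∀ i, ‖π i x - ‖π i x‖ • w i‖ ^ 2 ≤ C i * (‖π i x‖ * gap i x) :=
    fun x hx i => hC i _ (hx i)
  have hx₀W : W (τ x₀) = x₀ := by
    have h1 : ∑ i, gap i x₀ = 0 := by rw [hgapsum, hlx₀, sub_self]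
    have h2 := (Finset.sum_eq_zero_iff_of_nonneg fun i _ => hgap0 i x₀ hx₀).1 h1
    have h3 : ‖x₀ - W (τ x₀)‖ ≤ 0 := by
      refine (hdiff x₀).trans_eq (Finset.sum_eq_zero fun i hi => ?_)
      have h4 := hray x₀ hx₀ i
      rw [h2 i hi, mul_zero, mul_zero] at h4
      rw [pow_eq_zero_iff two_ne_zero |>.1 (le_antisymm h4 (sq_nonneg _)), mul_zero]
    exact (sub_eq_zero.1 (norm_le_zero_iff.1 h3)).symm
  obtain ⟨C₁, hC₁, hpoly⟩ := exists_polyhedral_error_bound (A.comp W)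
  -- The radius `‖A‖` suffices because only `x` with `‖x - x₀‖ ≤ 1` matter.
  obtain ⟨m, hm, hqm⟩ := hq.strongConvexOn (Metric.closedBall b ‖A‖)
    (isCompact_closedBall _ _) (convex_closedBall _ _)
  set K₁ := ∑ i, ‖e i‖ * √(C i * (‖π i‖ * (‖x₀‖ + 1))) with hK₁
  have hK₁0 : 0 ≤ K₁ := Finset.sum_nonneg fun i _ => by positivity
  set K₂ := √(2 / (r * m)) with hK₂
  set K := K₁ + ‖W‖ * (C₁ * (‖A‖ * K₁ + K₂)) with hK
  refine ⟨K ^ 2 + 1, by positivity, fun x hx hqx hxx₀ => ?_⟩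
  set δ := H x - H x₀ with hδ
  -- Here `l x - l x₀ = -r * q' (A x - b)`, and strong convexity with `q b = 0` and `q (A x) ≤ 0`
  -- bounds this below by the quadratic term.
  have hδle : (∑ i, gap i x) + r * (m / 2 * ‖A x - b‖ ^ 2) ≤ δ := by
    have hball : A x ∈ Metric.closedBall b ‖A‖ := by
      rw [mem_closedBall_iff_norm, hb, ← map_sub]
      exact (A.le_opNorm _).trans (mul_le_of_le_one_right (norm_nonneg _) hxx₀)
    have h1 := add_fderiv_le_of_strongConvexOn hqm (Metric.mem_closedBall_self (norm_nonneg _)) hball hq'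
    rw [hqb, map_sub] at h1
    have h2 : q' (A x) - q' b + m / 2 * ‖A x - b‖ ^ 2 ≤ 0 := by linarith
    have h3 := mul_nonpos_of_nonneg_of_nonpos hr.le h2
    rw [hgapsum, hδ, hlx₀, hlA, hlA]
    linarith
  have hgsum0 : 0 ≤ ∑ i, gap i x := Finset.sum_nonneg fun i _ => hgap0 i x hx
  have hδ0 : 0 ≤ δ := by
    have : 0 ≤ r * (m / 2 * ‖A x - b‖ ^ 2) := by positivity
    linarith
  have hest₁ : ‖x - W (τ x)‖ ≤ K₁ * √δ := by
    refine (hdiff x).trans ?_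
    rw [hK₁, Finset.sum_mul]
    refine Finset.sum_le_sum fun i _ => ?_
    rw [mul_assoc, ← Real.sqrt_mul (mul_nonneg (hC0 i) (by positivity))]
    refine mul_le_mul_of_nonneg_left (Real.le_sqrt_of_sq_le ((hray x hx i).trans ?_))
      (norm_nonneg _)
    rw [mul_assoc]
    have h1 : ‖π i x‖ ≤ ‖π i‖ * (‖x₀‖ + 1) := by
      refine ((π i).le_opNorm x).trans (mul_le_mul_of_nonneg_left ?_ (norm_nonneg _))
      have := norm_add_le x₀ (x - x₀)
      rw [add_sub_cancel] at this
      linarith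
    have h2 : gap i x ≤ δ := by
      have h3 := Finset.single_le_sum (f := fun i => gap i x) (fun i _ => hgap0 i x hx)
        (Finset.mem_univ i)
      have : 0 ≤ r * (m / 2 * ‖A x - b‖ ^ 2) := by positivity
      linarith
    exact mul_le_mul_of_nonneg_left
      (mul_le_mul h1 h2 (hgap0 i x hx) (by positivity)) (hC0 i)
  have hest₂ : ‖A x - b‖ ≤ K₂ * √δ := by
    rw [hK₂, ← Real.sqrt_mul (by positivity)]
    refine Real.le_sqrt_of_sq_le ?_
    rw [div_mul_eq_mul_div, le_div_iff₀ (by positivity)]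
    nlinarith
  -- The reference point `τ x₀` is admissible since `W (τ x₀) = x₀`, so the corrected `t'` satisfies
  -- `A (W t') = b`.
  obtain ⟨t', ht'0, ht'B, ht'⟩ := hpoly (τ x) (τ x₀) (hτ0 x) (hτ0 x₀)
  simp only [ContinuousLinearMap.comp_apply, hx₀W, ← hb] at ht'B ht'
  refine ⟨W t', hWD t' ht'0, by rw [ht'B, hqb], ?_, ?_⟩
  -- On the cone `H = l`, and `l` depends only on the image under `A`; hence `W t'` has the minimal
  -- value.
  · rw [hHW t' ht'0, hlx₀, hlA, hlA, ht'B]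
  have hest₃ : ‖A (W (τ x)) - b‖ ≤ (‖A‖ * K₁ + K₂) * √δ := by
    have h1 : A (W (τ x)) - b = (A x - b) - A (x - W (τ x)) := by rw [map_sub]; abel
    have h2 := norm_sub_le (A x - b) (A (x - W (τ x)))
    have h3 := (A.le_opNorm (x - W (τ x))).trans
      (mul_le_mul_of_nonneg_left hest₁ (norm_nonneg _))
    rw [h1]
    linarith
  have hest₄ : ‖x - W t'‖ ≤ K * √δ := by
    have h1 : x - W t' = (x - W (τ x)) - W (t' - τ x) := by rw [map_sub]; abel
    have h2 := norm_sub_le (x - W (τ x)) (W (t' - τ x))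
    have h3 := (W.le_opNorm (t' - τ x)).trans (mul_le_mul_of_nonneg_left
      (ht'.trans (mul_le_mul_of_nonneg_left hest₃ hC₁)) (norm_nonneg _))
    rw [h1, hK]
    linarith
  calc ‖x - W t'‖ ^ 2 ≤ (K * √δ) ^ 2 := pow_le_pow_left₀ (norm_nonneg _) hest₄ 2
    _ = K ^ 2 * δ := by rw [mul_pow, Real.sq_sqrt hδ0]
    _ ≤ (K ^ 2 + 1) * δ := by linarith

end Blocks

/-! ### Coordinate blocks of a partition as an instance of the block setting. -/

section GroupGauge

variable {n s : ℕ}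

/-- The restriction `x ↦ x_J` as a continuous linear map. -/
def subvecL (J : Finset (Fin n)) : EuclideanSpace ℝ (Fin n) →L[ℝ] EuclideanSpace ℝ J :=
  LinearMap.toContinuousLinearMap
    { toFun := subvec J
      map_add' := fun _ _ => rfl
      map_smul' := fun _ _ => rfl }

/-- Extension by zero of a vector indexed by `J`. -/
def extendL (J : Finset (Fin n)) : EuclideanSpace ℝ J →L[ℝ] EuclideanSpace ℝ (Fin n) :=
  LinearMap.toContinuousLinearMap
    { toFun := fun u => WithLp.toLp 2 fun i => if h : i ∈ J then u ⟨i, h⟩ else 0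
      map_add' := fun u v => by
        ext i; by_cases h : i ∈ J <;> simp [h]
      map_smul' := fun c u => by
        ext i; by_cases h : i ∈ J <;> simp [h] }

/-- `x ↦ A x` as a continuous linear map. -/
def matMulL (A : Matrix (Fin s) (Fin n) ℝ) :
    EuclideanSpace ℝ (Fin n) →L[ℝ] EuclideanSpace ℝ (Fin s) :=
  LinearMap.toContinuousLinearMap
    { toFun := matMul A
      map_add' := fun x y => by simp [matMul, Matrix.mulVec_add]
      map_smul' := fun c x => by simp [matMul, Matrix.mulVec_smul] }

@[simp] theorem subvecL_apply (J : Finset (Fin n)) (x) : subvecL J x = subvec J x := rfl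

@[simp] theorem matMulL_apply (A : Matrix (Fin s) (Fin n) ℝ) (x) : matMulL A x = matMul A x := rfl

theorem extendL_apply (J : Finset (Fin n)) (u) (i : Fin n) :
    extendL J u i = if h : i ∈ J then u ⟨i, h⟩ else 0 := rfl

theorem subvecL_extendL (J : Finset (Fin n)) (u) : subvecL J (extendL J u) = u := by
  ext i
  change extendL J u i = u i
  rw [extendL_apply, dif_pos i.2]

theorem subvecL_extendL_of_disjoint {I J : Finset (Fin n)} (h : Disjoint I J) (u) :
    subvecL J (extendL I u) = 0 := by
  ext i
  change extendL I u i = 0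
  rw [extendL_apply, dif_neg fun hi => Finset.disjoint_left.1 h hi i.2]

variable (P : Finpartition (Finset.univ : Finset (Fin n)))

theorem sum_extendL_subvecL (x : EuclideanSpace ℝ (Fin n)) :
    ∑ J : P.parts, extendL J.1 (subvecL J.1 x) = x := by
  ext i
  obtain ⟨J, hJ, hiJ⟩ := P.exists_mem (Finset.mem_univ i)
  rw [WithLp.ofLp_sum, Finset.sum_apply, Finset.sum_eq_single ⟨J, hJ⟩]
  · rw [extendL_apply, dif_pos hiJ]; rfl
  · intro I _ hI
    rw [extendL_apply, dif_neg]
    intro hiI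
    exact hI (Subtype.ext (P.eq_of_mem_parts I.2 hJ hiI hiJ))
  · simp

variable {P} {κ : (J : Finset (Fin n)) → EuclideanSpace ℝ J → EReal}

theorem groupGauge_eq_sum_coe_sort (x : EuclideanSpace ℝ (Fin n)) :
    groupGauge P κ x = ∑ J : P.parts, (((‖subvec J.1 x‖ : ℝ) : EReal) + κ J.1 (subvec J.1 x)) :=
  (Finset.sum_coe_sort P.parts
    fun J => (((‖subvec J x‖ : ℝ) : EReal) + κ J (subvec J x))).symm

theorem groupGauge_nonneg (hκ : ∀ J ∈ P.parts, IsClosedGauge (κ J))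
    (x : EuclideanSpace ℝ (Fin n)) : 0 ≤ groupGauge P κ x :=
  Finset.sum_nonneg fun J hJ =>
    add_nonneg (EReal.coe_nonneg.2 (norm_nonneg _)) ((hκ J hJ).nonneg _)

theorem groupGauge_eq_blockSum (hκ : ∀ J ∈ P.parts, IsClosedGauge (κ J))
    {x : EuclideanSpace ℝ (Fin n)}
    (hx : x ∈ blockDom (fun J : P.parts => subvecL J.1) (fun J => κ J.1)) :
    groupGauge P κ x =
      (blockSum (fun J : P.parts => subvecL J.1) (fun J => κ J.1) x : EReal) := by
  rw [groupGauge_eq_sum_coe_sort, blockSum]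
  have hcoe : ∀ (S : Finset P.parts) (f : P.parts → ℝ),
      ((∑ J ∈ S, f J : ℝ) : EReal) = ∑ J ∈ S, (f J : EReal) := fun S f => by
    classical
    induction S using Finset.induction_on with
    | empty => simp
    | insert a S ha ih => rw [Finset.sum_insert ha, Finset.sum_insert ha, EReal.coe_add, ih]
  rw [hcoe]
  refine Finset.sum_congr rfl fun J _ => ?_
  rw [EReal.coe_add, (hκ J.1 J.2).coe_toReal (hx J)]
  rfl

theorem dom_groupGauge (hκ : ∀ J ∈ P.parts, IsClosedGauge (κ J)) :
    dom (groupGauge P κ) = blockDom (fun J : P.parts => subvecL J.1) (fun J => κ J.1) := by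
  ext x
  refine ⟨fun hx J => ?_, fun hx => ?_⟩
  · have h1 : κ J.1 (subvec J.1 x) ≤ groupGauge P κ x := by
      refine le_trans ?_ (Finset.single_le_sum (f := fun J =>
        (((‖subvec J x‖ : ℝ) : EReal) + κ J (subvec J x))) (fun J hJ =>
        add_nonneg (EReal.coe_nonneg.2 (norm_nonneg _)) ((hκ J hJ).nonneg _)) J.2)
      exact le_add_of_nonneg_left (EReal.coe_nonneg.2 (norm_nonneg _))
    exact h1.trans_lt hx
  · change groupGauge P κ x < ⊤
    rw [groupGauge_eq_blockSum hκ hx]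
    exact EReal.coe_lt_top _

theorem lowerSemicontinuous_add_of_nonneg {X : Type*} [TopologicalSpace X] {f g : X → EReal}
    (hf : LowerSemicontinuous f) (hg : LowerSemicontinuous g) (hf0 : ∀ x, 0 ≤ f x)
    (hg0 : ∀ x, 0 ≤ g x) : LowerSemicontinuous fun x => f x + g x :=
  hf.add' hg fun x => EReal.continuousAt_add
    (Or.inr (EReal.bot_lt_zero.trans_le (hg0 x)).ne')
    (Or.inl (EReal.bot_lt_zero.trans_le (hf0 x)).ne')

theorem lowerSemicontinuous_sum_of_nonneg {X ι : Type*} [TopologicalSpace X] (S : Finset ι)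
    {f : ι → X → EReal} (hf : ∀ i ∈ S, LowerSemicontinuous (f i))
    (hf0 : ∀ i ∈ S, ∀ x, 0 ≤ f i x) : LowerSemicontinuous fun x => ∑ i ∈ S, f i x := by
  classical
  induction S using Finset.induction_on with
  | empty => simpa using lowerSemicontinuous_const
  | insert a S ha ih =>
    simp only [Finset.sum_insert ha]
    exact lowerSemicontinuous_add_of_nonneg (hf a (Finset.mem_insert_self a S))
      (ih (fun i hi => hf i (Finset.mem_insert_of_mem hi))
        fun i hi => hf0 i (Finset.mem_insert_of_mem hi))
      (hf0 a (Finset.mem_insert_self a S))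
      fun x => Finset.sum_nonneg fun i hi => hf0 i (Finset.mem_insert_of_mem hi) x

theorem lowerSemicontinuous_groupGauge (hκ : ∀ J ∈ P.parts, IsClosedGauge (κ J)) :
    LowerSemicontinuous (groupGauge P κ) := by
  refine lowerSemicontinuous_sum_of_nonneg P.parts (fun J hJ => ?_) fun J hJ x =>
    add_nonneg (EReal.coe_nonneg.2 (norm_nonneg _)) ((hκ J hJ).nonneg _)
  have hc : Continuous fun x : EuclideanSpace ℝ (Fin n) => subvec J x := (subvecL J).continuous
  exact lowerSemicontinuous_add_of_nonneg
    (continuous_coe_real_ereal.comp hc.norm).lowerSemicontinuous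
    ((hκ J hJ).closed.comp hc)
    (fun x => EReal.coe_nonneg.2 (norm_nonneg _)) fun x => (hκ J hJ).nonneg _

end GroupGauge

/-! ### Indicator functions. -/

section Indicator

variable {E : Type*}

theorem indicatorFn_nonneg (C : Set E) (x : E) : 0 ≤ indicatorFn C x := by
  unfold indicatorFn; split_ifs <;> simp

theorem indicatorFn_of_mem {C : Set E} {x : E} (hx : x ∈ C) : indicatorFn C x = 0 := if_pos hx

theorem indicatorFn_of_notMem {C : Set E} {x : E} (hx : x ∉ C) : indicatorFn C x = ⊤ := if_neg hx

theorem lowerSemicontinuous_indicatorFn [TopologicalSpace E] {C : Set E} (hC : IsClosed C) :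
    LowerSemicontinuous (indicatorFn C) := by
  intro x y hy
  by_cases hx : x ∈ C
  · rw [indicatorFn_of_mem hx] at hy
    exact Eventually.of_forall fun z => hy.trans_le (indicatorFn_nonneg C z)
  · filter_upwards [hC.isOpen_compl.mem_nhds hx] with z hz
    rw [indicatorFn_of_notMem hz]
    rwa [indicatorFn_of_notMem hx] at hy

end Indicator

end KLExp
end

/-! ### The theorem, by reduction to the block setting. -/

theorem mainTheorem4 {n s : ℕ}
    (P : Finpartition (Finset.univ : Finset (Fin n)))
    (κ : (J : Finset (Fin n)) → EuclideanSpace ℝ J → EReal)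
    (hκ : ∀ J ∈ P.parts, KLExp.IsClosedGauge (κ J))
    (q : EuclideanSpace ℝ (Fin s) → ℝ) (A : Matrix (Fin s) (Fin n) ℝ)
    (hq : KLExp.LocallyStronglyConvexC2 q)
    (hSlater : ∃ x ∈ KLExp.dom (KLExp.groupGauge P κ), q (KLExp.matMul A x) < 0)
    (h_origin : (0 : EuclideanSpace ℝ (Fin n)) ∉
      KLExp.feasibleSet (KLExp.groupGauge P κ) q A) :
    KLExp.IsKLFunctionWithExponent
      (KLExp.extObjective (KLExp.groupGauge P κ) q A) (1 / 2) := by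
  open KLExp in
  set π : ∀ J : P.parts, EuclideanSpace ℝ (Fin n) →L[ℝ] EuclideanSpace ℝ J.1 :=
    fun J => subvecL J.1 with hπ
  set k : ∀ J : P.parts, EuclideanSpace ℝ J.1 → EReal := fun J => κ J.1 with hk
  have hκ' : ∀ J : P.parts, IsClosedGauge (k J) := fun J => hκ J.1 J.2
  set F := extObjective (groupGauge P κ) q A with hF
  have hF0 : ∀ x, 0 ≤ F x := fun x => add_nonneg (groupGauge_nonneg hκ x) (indicatorFn_nonneg _ x)
  have hbot : ∀ x, ⊥ < F x := fun x => EReal.bot_lt_zero.trans_le (hF0 x)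
  have hFfeas : ∀ x, q (matMulL A x) ≤ 0 → F x = groupGauge P κ x := fun x hx => by
    rw [hF, extObjective, indicatorFn_of_mem (show x ∈ {y | q (matMul A y) ≤ 0} from hx),
      add_zero]
  have hdomg : dom (groupGauge P κ) = blockDom π k := dom_groupGauge hκ
  have hdom : ∀ x, x ∈ dom F ↔ x ∈ blockDom π k ∧ q (matMulL A x) ≤ 0 := fun x => by
    rw [← hdomg]
    by_cases hx : q (matMulL A x) ≤ 0
    · simp only [hx, and_true]
      change F x < ⊤ ↔ groupGauge P κ x < ⊤
      rw [hFfeas x hx]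
    · simp only [hx, and_false, iff_false]
      change ¬ F x < ⊤
      rw [hF, extObjective, indicatorFn_of_notMem (show x ∉ {y | q (matMul A y) ≤ 0} from hx),
        EReal.add_top_of_ne_bot (EReal.bot_lt_zero.trans_le (groupGauge_nonneg hκ x)).ne']
      exact lt_irrefl _
  have hFval : ∀ x ∈ dom F, (F x).toReal = blockSum π k x := fun x hx => by
    rw [hFfeas x ((hdom x).1 hx).2, groupGauge_eq_blockSum hκ ((hdom x).1 hx).1, EReal.toReal_coe]
  have hcvx : ConvexOn ℝ Set.univ fun x => q (matMulL A x) :=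
    hq.convexOn.comp_linearMap (matMulL A).toLinearMap
  have hH : ConvexOn ℝ (blockDom π k) (blockSum π k) := convexOn_blockSum hκ'
  have hconv : ConvexOn ℝ (dom F) fun x => (F x).toReal := by
    have h1 : Convex ℝ (dom F) := by
      have h2 : dom F = blockDom π k ∩ {x ∈ Set.univ | q (matMulL A x) ≤ 0} := by
        ext x; rw [hdom]; simp
      rw [h2]
      exact hH.1.inter (hcvx.convex_le 0)
    exact (hH.subset (fun x hx => ((hdom x).1 hx).1) h1).congr fun x hx => (hFval x hx).symm
  obtain ⟨y, hy, hqy⟩ := hSlater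
  rw [hdomg] at hy
  -- The origin always lies in the domain of the gauge sum, so its infeasibility can only come from
  -- the constraint.
  have hq0 : 0 < q 0 := by
    by_contra h
    refine h_origin ⟨?_, ?_⟩
    · rw [hdomg]; exact zero_mem_blockDom hκ'
    · rw [← matMulL_apply, map_zero]; exact not_lt.1 h
  refine ⟨by norm_num, ⟨hbot, y, (hdom y).2 ⟨hy, hqy.le⟩⟩, ?_, fun x₀ hx₀ => ?_⟩
  · refine lowerSemicontinuous_add_of_nonneg (lowerSemicontinuous_groupGauge hκ)
      (lowerSemicontinuous_indicatorFn ?_) (groupGauge_nonneg hκ) (indicatorFn_nonneg _)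
    exact isClosed_le (hq.contDiff.continuous.comp (matMulL A).continuous) continuous_const
  · obtain ⟨v, hv⟩ := hx₀
    have hx₀D : x₀ ∈ dom F := hv.1
    refine hasKLExponentAt_half_of_growth hbot hconv hx₀D fun hmin => ?_
    obtain ⟨C, hC, hgrow⟩ := exists_quadratic_growth (π := π) (e := fun J => extendL J.1)
      (fun J u => subvecL_extendL J.1 u)
      (fun I J u hIJ => subvecL_extendL_of_disjoint
        (P.disjoint I.2 J.2 fun h => hIJ (Subtype.ext h)) u)
      (sum_extendL_subvecL P) hκ' hq (matMulL A) hy hqy hq0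
      ((hdom x₀).1 hx₀D).1 ((hdom x₀).1 hx₀D).2 (fun x hx hqx => by
        have hxD := (hdom x).2 ⟨hx, hqx⟩
        rw [← hFval x₀ hx₀D, ← hFval x hxD]
        exact hmin x hxD)
    refine ⟨C, hC, fun x hx hxx₀ => ?_⟩
    obtain ⟨x', hx'D, hqx', heq, hle⟩ := hgrow x ((hdom x).1 hx).1 ((hdom x).1 hx).2 hxx₀
    have hx' := (hdom x').2 ⟨hx'D, hqx'⟩
    exact ⟨x', hx', by rw [hFval x' hx', hFval x₀ hx₀D, heq],
      by rw [hFval x hx, hFval x₀ hx₀D]; exact hle⟩
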